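/- Let $\mathbb F_q$ be a finite field and let $C\subseteq\mathbb F_q^n$ be a linear $[n,k,2]_q$ code (dimension $k$, minimum Hamming distance $2$) that is completely regular, i.e. for every $x\in\mathbb F_q^n$ and every $i$ the number of codewords at Hamming distance $i$ from $x$ depends only on $i$ and on the distance $d(x,C)$. Suppose that $C$ has covering radius $\rho=\max_x d(x,C)=1$. Then the number $n_a$ of codewords at distance $1$ from a vector $x\notin C$ does not depend on $x$, and one of the following holds. (A generator matrix of a code is a matrix whose rows form a basis of the code.) 1. $n_a=n$, $k=n-1$, and $C$ has a generator matrix $G=[G_1]$, where $G_1$ is a generator matrix of a completely regular $[n_a,n_a-1,2]_q$ code. 2. $n_a<n$, $k<n-1$, $n_a$ divides $n$ and, after a suitable permutation of the coordinates, $C$ has a generator matrix $$ G=\left[\begin{array}{ccc} G_1 & 0 & 0\\ 0 & \ddots & 0\\ 0 & 0 & G_{n/n_a}\\ \hline M_1 & \cdots & M_{n/n_a} \end{array}\right], $$ where each $G_i$ is a generator matrix of a completely regular $[n_a,n_a-1,2]_q$ code, and each $M_i$ has $n_a$ columns, of which $n_a-1$ are zero and one is a nonzero column $\mathbf h_i$,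 such that $[\mathbf h_1\ \cdots\ \mathbf h_{n/n_a}]$ is a generator matrix of a Hamming code. Here a Hamming code is a code with a parity check matrix over $\mathbb F_q$ with $m\ge 2$ rows whose columns consist of exactly one nonzero vector from each one-dimensional subspace of $\mathbb F_q^m$. -/

import Mathlib

namespace CRCode

open Module

section General

variable {F ι : Type*} [DecidableEq F] [Fintype ι]

/-- `d` is the minimum distance between two different words of `C`. -/
def IsMinDist (C : Set (ι → F)) (d : ℕ) : Prop :=
  IsLeast {e : ℕ | ∃ x ∈ C, ∃ y ∈ C, x ≠ y ∧ hammingDist x y = e} d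

/-- The distance of the vector `v` to the (nonempty) code `C`. -/
noncomputable def distToCode (C : Set (ι → F)) (v : ι → F) : ℕ :=
  sInf {e : ℕ | ∃ x ∈ C, hammingDist v x = e}

/-- `ρ` is the covering radius of `C`: the largest distance of a vector to `C`. -/
def IsCoveringRadius (C : Set (ι → F)) (ρ : ℕ) : Prop :=
  IsGreatest (Set.range (distToCode C)) ρ

/-- The number of codewords at distance `i` from `x`. -/
noncomputable def numAtDist (C : Set (ι → F)) (x : ι → F) (i : ℕ) : ℕ :=
  {c : ι → F | c ∈ C ∧ hammingDist x c = i}.ncard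

/-- `C` is completely regular: the number of codewords at distance `i` from `x`
depends only on `i` and on the distance of `x` to `C`. -/
def IsCompletelyRegular (C : Set (ι → F)) : Prop :=
  ∀ x y : ι → F, distToCode C x = distToCode C y → ∀ i : ℕ, numAtDist C x i = numAtDist C y i

end General

section Linear

variable {F : Type*} [Field F] [DecidableEq F] {ι : Type*} [Fintype ι]

/-- `C` is a linear code `[n, k, d]` whose length `n` is the number of elements of `ι`. -/
def IsLinearCode (C : Submodule F (ι → F)) (k d : ℕ) : Prop :=
  finrank F C = k ∧ IsMinDist (C : Set (ι → F)) d

end Linear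

/-- The rows of `G` form a basis of `C`. -/
def IsGeneratorMatrix {F : Type*} [Field F] {ι κ : Type*} (G : Matrix κ ι F)
    (C : Submodule F (ι → F)) : Prop :=
  LinearIndependent F G.row ∧ Submodule.span F (Set.range G.row) = C

/-- `D` is a Hamming code: it has a parity check matrix with `m ≥ 2` rows whose columns are
nonzero and contain exactly one representative of every one-dimensional subspace of `F ^ m`. -/
def IsHammingCode {F : Type*} [Field F] {ι : Type*} [Fintype ι]
    (D : Submodule F (ι → F)) : Prop :=
  ∃ m : ℕ, 2 ≤ m ∧ ∃ H : Matrix (Fin m) ι F,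
    (∀ j, H.col j ≠ 0) ∧
    (∀ v : Fin m → F, v ≠ 0 → ∃! j, ∃ c : F, v = c • H.col j) ∧
    ∀ x : ι → F, x ∈ D ↔ H.mulVec x = 0

/-- `G` is a generator matrix of a completely regular code `[m, m - 1, 2]`. -/
def IsBlock {F : Type*} [Field F] [DecidableEq F] {m : ℕ}
    (G : Matrix (Fin (m - 1)) (Fin m) F) : Prop :=
  ∃ D : Submodule F (Fin m → F), IsGeneratorMatrix G D ∧ IsLinearCode D (m - 1) 2 ∧
    IsCompletelyRegular (D : Set (Fin m → F))

/-- The matrix whose upper part is block diagonal with blocks `G i`, and whose lower part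
consists of the blocks `M i` side by side. The column `(j, i)` is the `j`-th column of the
`i`-th block. -/
def stackedMatrix {F : Type*} [Field F] {m t r : ℕ}
    (G : Fin t → Matrix (Fin (m - 1)) (Fin m) F) (M : Fin t → Matrix (Fin r) (Fin m) F) :
    Matrix ((Fin (m - 1) × Fin t) ⊕ Fin r) (Fin m × Fin t) F :=
  Matrix.fromRows (Matrix.blockDiagonal G) (Matrix.of fun a p => M p.2 a p.1)

end CRCode

namespace CRCode

open Module

/-! ### Words of weight one and two. -/

section Hamming

variable {F ι : Type*} [Field F] [DecidableEq F] [Fintype ι]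

/-! Let `σ` be a syndrome map: linear, onto `F ^ (n - k)`, with kernel `C`. Its values on the unit
vectors are the parity check columns. Minimum distance 2 makes them nonzero with two of them
proportional, and covering radius 1 puts a column on every line of the syndrome space. The codewords
at distance 1 from `x ∉ C` correspond to the columns proportional to `σ x`
(`numAtDist_one_eq_ncard`), so complete regularity says that every line carries the same number `m`
of columns.

If `n - k = 1` there is a single line and `m = n`. Otherwise the columns split into `n / m` classes
of size `m`, and one representative per class gives a parity check matrix of a Hamming code. The
relations inside each class yield the blocks `G i`; the relations between representatives yield the
lower rows (`exists_stackedMatrix`). All these rows are codewords, are independent, and number `(m -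
1) t + (t - s) = n - s`, where `t = n / m` and `s = n - k`. -/

theorem hammingDist_eq_hammingNorm_sub (x y : ι → F) :
    hammingDist x y = hammingNorm (x - y) := by
  rw [hammingDist_comm, hammingDist_eq_hammingNorm, neg_add_eq_sub]

variable [DecidableEq ι]

theorem hammingNorm_single {j : ι} {c : F} (hc : c ≠ 0) :
    hammingNorm (Pi.single j c : ι → F) = 1 := by
  rw [hammingNorm, Finset.card_eq_one]
  refine ⟨j, ?_⟩
  ext i
  by_cases h : i = j
  · subst h; simp [hc]
  · simp [h]

theorem hammingNorm_eq_one_iff {x : ι → F} :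
    hammingNorm x = 1 ↔ ∃ j, ∃ c : F, c ≠ 0 ∧ x = Pi.single j c := by
  constructor
  · intro h
    rw [hammingNorm, Finset.card_eq_one] at h
    obtain ⟨j, hj⟩ := h
    have hmem : ∀ i, x i ≠ 0 ↔ i = j := fun i => by
      simpa using Finset.ext_iff.1 hj i
    refine ⟨j, x j, (hmem j).2 rfl, ?_⟩
    ext i
    by_cases h : i = j
    · subst h; simp
    · simpa [h] using (hmem i)
  · rintro ⟨j, c, hc, rfl⟩
    exact hammingNorm_single hc

theorem exists_single_add_single_of_hammingNorm_eq_two {x : ι → F} (h : hammingNorm x = 2) :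
    ∃ i j, i ≠ j ∧ ∃ a b : F, a ≠ 0 ∧ b ≠ 0 ∧ x = Pi.single i a + Pi.single j b := by
  rw [hammingNorm, Finset.card_eq_two] at h
  obtain ⟨i, j, hij, hx⟩ := h
  have hmem : ∀ l, x l ≠ 0 ↔ l = i ∨ l = j := fun l => by
    simpa using Finset.ext_iff.1 hx l
  refine ⟨i, j, hij, x i, x j, (hmem i).2 (Or.inl rfl), (hmem j).2 (Or.inr rfl), ?_⟩
  ext l
  by_cases h1 : l = i
  · subst h1; simp [hij]
  · by_cases h2 : l = j
    · subst h2; simp [h1]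
    · simpa [h1, h2] using hmem l

end Hamming

/-! ### Distance to a linear code and its symmetries. -/

section Distance

variable {F ι : Type*} [Field F] [DecidableEq F] [Fintype ι]

theorem exists_hammingDist_eq_distToCode (C : Submodule F (ι → F)) (x : ι → F) :
    ∃ y ∈ C, hammingDist x y = distToCode (C : Set (ι → F)) x :=
  Nat.sInf_mem (s := {e : ℕ | ∃ y ∈ (C : Set (ι → F)), hammingDist x y = e})
    ⟨_, 0, C.zero_mem, rfl⟩

theorem distToCode_eq_zero_iff (C : Submodule F (ι → F)) (x : ι → F) :
    distToCode (C : Set (ι → F)) x = 0 ↔ x ∈ C := by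
  constructor
  · intro h
    obtain ⟨y, hy, hxy⟩ := exists_hammingDist_eq_distToCode C x
    rw [h, hammingDist_eq_zero] at hxy
    exact hxy ▸ hy
  · intro h
    exact Nat.sInf_eq_zero.2 (Or.inl ⟨x, h, hammingDist_self x⟩)

theorem distToCode_eq_one {C : Submodule F (ι → F)}
    (hρ : IsCoveringRadius (C : Set (ι → F)) 1) {x : ι → F} (hx : x ∉ C) :
    distToCode (C : Set (ι → F)) x = 1 := by
  have h1 := hρ.2 ⟨x, rfl⟩
  have h2 := mt (distToCode_eq_zero_iff C x).1 hx
  omega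

/-- Nonzero scalings and translations by codewords are Hamming isometries that preserve `C`. -/
theorem numAtDist_smul_add (C : Submodule F (ι → F)) (x : ι → F) {d : ι → F} (hd : d ∈ C)
    {c : F} (hc : c ≠ 0) (i : ℕ) :
    numAtDist (C : Set (ι → F)) (c • x + d) i = numAtDist (C : Set (ι → F)) x i := by
  have hinj : Function.Injective fun z : ι → F => c • z + d := fun a b hab =>
    smul_right_injective _ hc (add_right_cancel hab)
  have hdist : ∀ z, hammingDist (c • x + d) (c • z + d) = hammingDist x z := fun z => by
    rw [hammingDist_eq_hammingNorm_sub, hammingDist_eq_hammingNorm_sub, add_sub_add_right_eq_sub,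
      ← smul_sub, hammingNorm_smul (fun _ => IsSMulRegular.of_ne_zero hc)]
  rw [numAtDist, numAtDist,
    ← Set.ncard_image_of_injective {z | z ∈ (C : Set (ι → F)) ∧ hammingDist x z = i} hinj]
  congr 1
  ext z
  constructor
  · rintro ⟨hz, hi⟩
    have hz' : c • (c⁻¹ • (z - d)) + d = z := by rw [smul_inv_smul₀ hc, sub_add_cancel]
    refine ⟨c⁻¹ • (z - d), ⟨C.smul_mem _ (C.sub_mem hz hd), ?_⟩, hz'⟩
    rw [← hdist, hz', hi]
  · rintro ⟨w, ⟨hw, hi⟩, rfl⟩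
    exact ⟨C.add_mem (C.smul_mem _ hw) hd, (hdist w).trans hi⟩

/-- A code whose syndromes outside the code are all proportional is completely regular. -/
theorem isCompletelyRegular_ker (φ : (ι → F) →ₗ[F] F) :
    IsCompletelyRegular (LinearMap.ker φ : Set (ι → F)) := by
  intro x y hxy i
  by_cases hx : φ x = 0
  · have hy : y ∈ LinearMap.ker φ := by
      rw [← distToCode_eq_zero_iff, ← hxy, distToCode_eq_zero_iff]; exact hx
    have h := numAtDist_smul_add (LinearMap.ker φ) y
      (d := x - y) (Submodule.sub_mem _ hx hy) one_ne_zero i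
    rwa [one_smul, add_sub_cancel] at h
  · have hy : φ y ≠ 0 := fun hy => hx <| by
      rw [← LinearMap.mem_ker, ← distToCode_eq_zero_iff, hxy, distToCode_eq_zero_iff]; exact hy
    -- The factor `φ x / φ y` gives the multiple of `y` the same syndrome as `x`, so the difference
    -- is a codeword.
    have h := numAtDist_smul_add (LinearMap.ker φ) y (d := x - (φ x / φ y) • y)
      (by simp [hy]) (div_ne_zero hx hy) i
    rwa [add_sub_cancel] at h

theorem IsMinDist.le_hammingNorm {C : Submodule F (ι → F)} {d : ℕ}
    (h : IsMinDist (C : Set (ι → F)) d) {x : ι → F} (hx : x ∈ C) (h0 : x ≠ 0) :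
    d ≤ hammingNorm x :=
  h.2 ⟨x, hx, 0, C.zero_mem, h0, hammingDist_zero_right x⟩

end Distance

/-! ### Generator matrices and blocks. -/

section Generator

variable {F ι : Type*} [Field F]

theorem exists_isGeneratorMatrix [Finite ι] (D : Submodule F (ι → F)) {r : ℕ}
    (hr : finrank F D = r) :
    ∃ G : Matrix (Fin r) ι F, IsGeneratorMatrix G D := by
  let b := finBasisOfFinrankEq F D hr
  refine ⟨fun i => b i, ?_, ?_⟩
  · exact b.linearIndependent.map' D.subtype D.ker_subtype
  · change Submodule.span F (Set.range fun i => (b i : ι → F)) = D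
    have h : (Set.range fun i => (b i : ι → F)) = D.subtype '' Set.range b := by
      rw [← Set.range_comp]; rfl
    rw [h, Submodule.span_image, b.span_eq, Submodule.map_subtype_top]

theorem IsGeneratorMatrix.row_mem {κ : Type*} {G : Matrix κ ι F} {D : Submodule F (ι → F)}
    (h : IsGeneratorMatrix G D) (i : κ) : G i ∈ D :=
  h.2 ▸ Submodule.subset_span ⟨i, rfl⟩

theorem isGeneratorMatrix_of_card {κ : Type*} [Finite ι] [Fintype κ] {G : Matrix κ ι F}
    {D : Submodule F (ι → F)} (hli : LinearIndependent F G.row) (hmem : ∀ i, G i ∈ D)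
    (hcard : finrank F D = Fintype.card κ) : IsGeneratorMatrix G D := by
  refine ⟨hli, Submodule.eq_of_le_of_finrank_eq ?_ ?_⟩
  · rw [Submodule.span_le]
    rintro _ ⟨i, rfl⟩
    exact hmem i
  · rw [finrank_span_eq_card hli, hcard]

/-- The words orthogonal to a vector without zero coordinates form a block. -/
theorem exists_isBlock [DecidableEq F] {m : ℕ} (hm : 2 ≤ m) (a : Fin m → F)
    (ha : ∀ j, a j ≠ 0) :
    ∃ G : Matrix (Fin (m - 1)) (Fin m) F, IsBlock G ∧ ∀ i, a ⬝ᵥ G i = 0 := by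
  let φ : (Fin m → F) →ₗ[F] F := dotProductBilin F F a
  have hφ : ∀ x, φ x = a ⬝ᵥ x := fun x => rfl
  have hφs : ∀ j c, φ (Pi.single j c) = a j * c := fun j c => by simp [hφ]
  let i₀ : Fin m := ⟨0, by omega⟩
  let i₁ : Fin m := ⟨1, by omega⟩
  have h01 : i₀ ≠ i₁ := by simp [i₀, i₁]
  have hsurj : Function.Surjective φ := fun c =>
    ⟨Pi.single i₀ ((a i₀)⁻¹ * c), by rw [hφs, mul_inv_cancel_left₀ (ha _)]⟩
  have hrank : finrank F (LinearMap.ker φ) = m - 1 := by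
    have h := φ.finrank_range_add_finrank_ker
    rw [LinearMap.range_eq_top.2 hsurj, finrank_top, finrank_self, finrank_fin_fun] at h
    omega
  obtain ⟨G, hG⟩ := exists_isGeneratorMatrix (LinearMap.ker φ) hrank
  refine ⟨G, ⟨_, hG, ⟨hrank, ?_, ?_⟩, isCompletelyRegular_ker φ⟩, hG.row_mem⟩
  · let w : Fin m → F := Pi.single i₀ (a i₁) - Pi.single i₁ (a i₀)
    have hw : w ∈ LinearMap.ker φ := by
      rw [LinearMap.mem_ker, map_sub, hφs, hφs, mul_comm, sub_self]
    have hnorm : hammingNorm w = 2 := by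
      rw [hammingNorm, Finset.card_eq_two]
      refine ⟨i₀, i₁, h01, ?_⟩
      ext l
      by_cases h1 : l = i₀
      · subst h1; simp [w, h01, ha]
      · by_cases h2 : l = i₁
        · subst h2; simp [w, h1, ha]
        · simp [w, h1, h2]
    refine ⟨w, hw, 0, Submodule.zero_mem _, ?_, by rw [hammingDist_zero_right, hnorm]⟩
    rintro h
    simp [h] at hnorm
  · rintro _ ⟨x, hx, y, hy, hxy, rfl⟩
    rw [hammingDist_eq_hammingNorm_sub]
    have h0 : hammingNorm (x - y) ≠ 0 := by rwa [Ne, hammingNorm_eq_zero, sub_eq_zero]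
    have h1 : hammingNorm (x - y) ≠ 1 := fun h => by
      obtain ⟨j, c, hc, h⟩ := hammingNorm_eq_one_iff.1 h
      have := Submodule.sub_mem _ hx hy
      rw [h, LinearMap.mem_ker, hφs] at this
      exact mul_ne_zero (ha j) hc this
    omega

end Generator

/-! ### Syndromes and parity check columns. -/

section Syndrome

variable {F V : Type*} [Field F] [AddCommGroup V] [Module F V] {n : ℕ}

theorem exists_syndrome_map {k : ℕ} (C : Submodule F (Fin n → F)) (hk : finrank F C = k) :
    ∃ σ : (Fin n → F) →ₗ[F] (Fin (n - k) → F),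
      Function.Surjective σ ∧ LinearMap.ker σ = C := by
  have h := C.finrank_quotient_add_finrank
  rw [finrank_fin_fun, hk] at h
  let f : ((Fin n → F) ⧸ C) ≃ₗ[F] (Fin (n - k) → F) :=
    LinearEquiv.ofFinrankEq _ _ (by rw [finrank_fin_fun]; omega)
  refine ⟨f.toLinearMap ∘ₗ C.mkQ, f.surjective.comp C.mkQ_surjective, ?_⟩
  rw [LinearMap.ker_comp, LinearEquiv.ker, ← LinearMap.ker, Submodule.ker_mkQ]

theorem map_single_eq_smul (σ : (Fin n → F) →ₗ[F] V) (j : Fin n) (c : F) :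
    σ (Pi.single j c) = c • σ (Pi.single j 1) := by
  rw [← map_smul, ← Pi.single_smul, smul_eq_mul, mul_one]

variable [DecidableEq F]

theorem map_single_ne_zero {σ : (Fin n → F) →ₗ[F] V}
    (h2 : IsMinDist (LinearMap.ker σ : Set (Fin n → F)) 2) (j : Fin n) :
    σ (Pi.single j 1) ≠ 0 := fun h => by
  have h1 := h2.le_hammingNorm (LinearMap.mem_ker.2 h) (by simp)
  rw [hammingNorm_single one_ne_zero] at h1
  omega

/-- A vector with syndrome `v` differs from some codeword in one coordinate, and that error has the
same syndrome. -/
theorem exists_eq_smul_map_single {σ : (Fin n → F) →ₗ[F] V} (hσ : Function.Surjective σ)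
    (hρ : IsCoveringRadius (LinearMap.ker σ : Set (Fin n → F)) 1) {v : V} (hv : v ≠ 0) :
    ∃ j, ∃ c : F, v = c • σ (Pi.single j 1) := by
  obtain ⟨x, rfl⟩ := hσ v
  obtain ⟨y, hy, hxy⟩ := exists_hammingDist_eq_distToCode (LinearMap.ker σ) x
  rw [distToCode_eq_one hρ hv, hammingDist_eq_hammingNorm_sub, hammingNorm_eq_one_iff] at hxy
  obtain ⟨j, c, -, h⟩ := hxy
  refine ⟨j, c, ?_⟩
  rw [← map_single_eq_smul, ← h, map_sub, LinearMap.mem_ker.1 hy, sub_zero]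

/-- The codewords at distance one from a vector outside the code correspond to the columns of
the parity check matrix that are proportional to the syndrome of the vector. -/
theorem numAtDist_one_eq_ncard {σ : (Fin n → F) →ₗ[F] V}
    (h0 : ∀ j, σ (Pi.single j 1) ≠ 0) {x : Fin n → F} (hx : σ x ≠ 0) :
    numAtDist (LinearMap.ker σ : Set (Fin n → F)) x 1 =
      {j | ∃ c : F, σ x = c • σ (Pi.single j 1)}.ncard := by
  symm
  have hne : ∀ j (c : F), σ x = c • σ (Pi.single j 1) → c ≠ 0 := by
    rintro j c h rfl
    exact hx (by rw [h, zero_smul])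
  refine Set.ncard_congr (fun j hj => x - Pi.single j hj.choose) ?_ ?_ ?_
  · intro j hj
    refine ⟨?_, ?_⟩
    · change σ _ = 0
      rw [map_sub, map_single_eq_smul, ← hj.choose_spec, sub_self]
    · rw [hammingDist_eq_hammingNorm_sub, sub_sub_cancel,
        hammingNorm_single (hne _ _ hj.choose_spec)]
  · intro i j hi hj h
    have h' := congrFun (sub_right_injective h) i
    by_contra hij
    rw [Pi.single_eq_same, Pi.single_eq_of_ne hij] at h'
    exact hne _ _ hi.choose_spec h'
  · rintro y ⟨hy, hxy⟩
    rw [hammingDist_eq_hammingNorm_sub, hammingNorm_eq_one_iff] at hxy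
    obtain ⟨j, c, -, h⟩ := hxy
    have hj : σ x = c • σ (Pi.single j 1) := by
      rw [← map_single_eq_smul, ← h, map_sub, LinearMap.mem_ker.1 hy, sub_zero]
    refine ⟨j, ⟨c, hj⟩, ?_⟩
    -- The scalar is unique because the column is nonzero, so the chosen one is `c`.
    have hc : (⟨c, hj⟩ : ∃ c : F, σ x = c • σ (Pi.single j 1)).choose = c :=
      smul_left_injective F (h0 j)
        ((⟨c, hj⟩ : ∃ c : F, σ x = c • σ (Pi.single j 1)).choose_spec.symm.trans hj)
    change x - Pi.single j (Exists.choose _) = y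
    rw [hc, ← h, sub_sub_cancel]

/-- A codeword of weight two is a linear relation between two columns. -/
theorem exists_proportional_columns {σ : (Fin n → F) →ₗ[F] V}
    (h2 : IsMinDist (LinearMap.ker σ : Set (Fin n → F)) 2) :
    ∃ i j, i ≠ j ∧ ∃ c : F, σ (Pi.single i 1) = c • σ (Pi.single j 1) := by
  obtain ⟨x, hx, y, hy, -, hxy⟩ := h2.1
  rw [hammingDist_eq_hammingNorm_sub] at hxy
  obtain ⟨i, j, hij, a, b, ha, -, h⟩ := exists_single_add_single_of_hammingNorm_eq_two hxy
  refine ⟨i, j, hij, -(a⁻¹ * b), ?_⟩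
  have h' : σ (x - y) = 0 := Submodule.sub_mem _ hx hy
  rw [h, map_add, map_single_eq_smul, map_single_eq_smul σ j, add_eq_zero_iff_eq_neg] at h'
  rw [neg_smul, mul_smul, ← smul_neg, ← h', inv_smul_smul₀ ha]

end Syndrome

/-! ### Equivalence relations with classes of equal size. -/

section Classes

/-- A finite type whose classes for an equivalence relation all have `m` elements is a product
in which the classes are the fibres of the second projection. -/
theorem exists_equiv_prod_of_card_classes {n m : ℕ} (hm : 0 < m) (r : Setoid (Fin n))
    (hr : ∀ i, {j | r i j}.ncard = m) :
    n / m * m = n ∧ ∃ e : Fin n ≃ Fin m × Fin (n / m), ∀ i j, r i j ↔ (e i).2 = (e j).2 := by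
  classical
  let f : Fin n → Quotient r := Quotient.mk r
  have hf : ∀ q, Fintype.card {x // f x = q} = m := fun q => by
    induction q using Quotient.inductionOn with
    | _ i =>
      rw [← hr i, ← Nat.card_coe_set_eq, Nat.card_eq_fintype_card]
      refine Fintype.card_congr (Equiv.subtypeEquivRight fun j => ?_)
      exact Quotient.eq.trans ⟨r.symm, r.symm⟩
  have hcard : n = Fintype.card (Quotient r) * m := by
    have h := Fintype.card_congr (Equiv.sigmaFiberEquiv f)
    rw [Fintype.card_sigma, Fintype.card_fin, Finset.sum_congr rfl fun q _ => hf q] at h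
    rw [Finset.sum_const, smul_eq_mul, Finset.card_univ] at h
    exact h.symm
  have hdiv : Fintype.card (Quotient r) = n / m :=
    (Nat.div_eq_of_eq_mul_left hm hcard).symm
  refine ⟨hdiv ▸ hcard.symm, ?_⟩
  let g := Fintype.equivFinOfCardEq hdiv
  let e : Fin n ≃ Fin m × Fin (n / m) :=
    (Equiv.sigmaFiberEquiv f).symm.trans <|
      (Equiv.sigmaCongrRight fun q => Fintype.equivFinOfCardEq (hf q)).trans <|
        (Equiv.sigmaEquivProd _ _).trans <| (Equiv.prodComm _ _).trans <|
          Equiv.prodCongr (Equiv.refl _) g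
  refine ⟨e, fun i j => ?_⟩
  change _ ↔ g (f i) = g (f j)
  rw [g.apply_eq_iff_eq]
  exact Quotient.eq.symm

end Classes

/-! ### Independence of the rows of the stacked matrix. -/

section Stacked

variable {F : Type*} [Field F] {m t r : ℕ}

/-- The matrix with the column `v` at `c` and zero columns elsewhere. -/
def singleColumn (c : Fin m) (v : Fin r → F) : Matrix (Fin r) (Fin m) F :=
  Matrix.of fun a j => if j = c then v a else 0

/-- Pairing the columns of block `i` with `a · i` kills the rows of `G i` and, as `a c i = 1`,
leaves the combination of the `h i b`. Hence the lower coefficients vanish first, then the upper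
ones block by block. -/
theorem linearIndependent_stackedMatrix (G : Fin t → Matrix (Fin (m - 1)) (Fin m) F)
    (hG : ∀ i, LinearIndependent F (G i).row) (h : Fin t → Fin r → F)
    (hh : LinearIndependent F (Matrix.of fun a i => h i a).row) (c : Fin m)
    (a : Fin m → Fin t → F) (hac : ∀ i, a c i = 1) (hGa : ∀ i l, (fun j => a j i) ⬝ᵥ G i l = 0) :
    LinearIndependent F (stackedMatrix G fun i => singleColumn c (h i)).row := by
  rw [Fintype.linearIndependent_iff] at hh ⊢
  intro g hg
  have key : ∀ j i, ∑ l, g (Sum.inl (l, i)) * G i l j +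
      (if j = c then ∑ b, g (Sum.inr b) * h i b else 0) = 0 := fun j i => by
    have := congrFun hg (j, i)
    simp only [Fintype.sum_sum_type, Fintype.sum_prod_type, Finset.sum_apply,
      Pi.smul_apply, Matrix.row, stackedMatrix, Matrix.fromRows_apply_inl,
      Matrix.fromRows_apply_inr, Matrix.blockDiagonal_apply, singleColumn, Matrix.of_apply,
      smul_eq_mul, mul_ite, mul_zero, Pi.zero_apply, Finset.sum_ite_eq', Finset.mem_univ,
      if_true] at this
    by_cases hj : j = c <;>
      simpa only [hj, if_true, if_false, Finset.sum_const_zero] using this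
  have hr : ∀ b, g (Sum.inr b) = 0 := by
    apply hh
    ext i
    have h1 : ∑ j, a j i * (∑ l, g (Sum.inl (l, i)) * G i l j +
      (if j = c then ∑ b, g (Sum.inr b) * h i b else 0)) = 0 :=
      Finset.sum_eq_zero fun j _ => by rw [key, mul_zero]
    have h2 : ∑ j, a j i * ∑ l, g (Sum.inl (l, i)) * G i l j = 0 := by
      simp_rw [Finset.mul_sum]
      rw [Finset.sum_comm]
      refine Finset.sum_eq_zero fun l _ => ?_
      rw [← mul_zero (g (Sum.inl (l, i))), ← hGa i l, dotProduct, Finset.mul_sum]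
      exact Finset.sum_congr rfl fun j _ => by ring
    simp_rw [mul_add] at h1
    rw [Finset.sum_add_distrib, h2, zero_add] at h1
    simpa [hac, Matrix.row] using h1
  rintro (⟨l, i⟩ | b)
  · refine Fintype.linearIndependent_iff.1 (hG i) (fun l => g (Sum.inl (l, i))) ?_ l
    ext j
    simpa [hr, Matrix.row] using key j i
  · exact hr b

end Stacked

/-! ### Hamming codes from the points of a projective space. -/

section Points

variable {F : Type*} [Field F] {s t : ℕ}

/-- The matrix whose columns represent all points of a projective space of dimension at least
one is the parity check matrix of a Hamming code; a generator matrix of this code has no zero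
column. -/
theorem exists_hamming_generator (hs : 2 ≤ s) (P : Fin t → Fin s → F) (h0 : ∀ i, P i ≠ 0)
    (hP : ∀ v : Fin s → F, v ≠ 0 → ∃! i, ∃ c : F, v = c • P i) :
    s ≤ t ∧ ∃ h : Fin t → Fin (t - s) → F, (∀ i, h i ≠ 0) ∧ (∀ b, ∑ i, h i b • P i = 0) ∧
      ∃ D : Submodule F (Fin t → F), IsHammingCode D ∧
        IsGeneratorMatrix (Matrix.of fun a i => h i a) D := by
  let φ : (Fin t → F) →ₗ[F] (Fin s → F) := Fintype.linearCombination F P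
  have hφ : ∀ x, φ x = ∑ i, x i • P i := fun x => Fintype.linearCombination_apply F P x
  have hφs : ∀ i c, φ (Pi.single i c) = c • P i := fun i c =>
    Fintype.linearCombination_apply_single F P i c
  have hsurj : Function.Surjective φ := fun v => by
    by_cases hv : v = 0
    · exact ⟨0, by rw [hv, map_zero]⟩
    · obtain ⟨i, ⟨c, hc⟩, -⟩ := hP v hv
      exact ⟨Pi.single i c, by rw [hφs, hc]⟩
  have hrank := φ.finrank_range_add_finrank_ker
  rw [LinearMap.range_eq_top.2 hsurj, finrank_top, finrank_fin_fun, finrank_fin_fun] at hrank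
  obtain ⟨G, hG⟩ := exists_isGeneratorMatrix (LinearMap.ker φ) (r := t - s) (by omega)
  refine ⟨by omega, fun i a => G a i, fun i hi => ?_, fun b => ?_, LinearMap.ker φ, ?_, hG⟩
  · have hzero : ∀ z ∈ LinearMap.ker φ, z i = 0 := by
      have hle : LinearMap.ker φ ≤ LinearMap.ker (LinearMap.proj i : (Fin t → F) →ₗ[F] F) := by
        rw [← hG.2, Submodule.span_le]
        rintro _ ⟨a, rfl⟩
        exact congrFun hi a
      exact hle
    -- Neither `w` nor `P i + w` lies on the line of `P i`, so both are multiples of other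
    -- representatives. The resulting relation is a codeword with entry 1 at `i`.
    obtain ⟨w, hw⟩ : ∃ w, ∀ c : F, c • P i ≠ w := by
      by_contra! h
      have := finrank_le_one (P i) h
      rw [finrank_fin_fun] at this
      omega
    have hsum : P i + w ≠ 0 := fun h => hw (-1) (by
      rw [neg_one_smul]; exact neg_eq_of_add_eq_zero_right h)
    have hw0 : w ≠ 0 := fun h => hw 0 (by rw [zero_smul, h])
    obtain ⟨j, ⟨b, hb⟩, -⟩ := hP w hw0
    obtain ⟨l, ⟨d, hd⟩, -⟩ := hP _ hsum
    have hij : i ≠ j := by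
      rintro rfl
      exact hw b hb.symm
    have hil : i ≠ l := by
      rintro rfl
      exact hw (d - 1) (by rw [sub_smul, ← hd, one_smul, add_sub_cancel_left])
    have := hzero (Pi.single i 1 + Pi.single j b - Pi.single l d) (by
      rw [LinearMap.mem_ker, map_sub, map_add, hφs, hφs, hφs, one_smul, ← hb, ← hd, sub_self])
    simp [hij, hil] at this
  · rw [← hφ]
    exact hG.row_mem b
  · refine ⟨s, hs, Matrix.of fun a i => P i a, h0, hP, fun x => ?_⟩
    rw [LinearMap.mem_ker, hφ]
    have : (Matrix.of fun a i => P i a).mulVec x = ∑ i, x i • P i := by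
      ext a
      simp [Matrix.mulVec, dotProduct, mul_comm]
    rw [this]

end Points

/-! ### Assembling the generator matrix. -/

section Structure

variable {F : Type*} [Field F] [DecidableEq F] {n s m : ℕ}

/-- The structure of a code whose parity check matrix contains `m` multiples of a representative
of each point of a projective space of dimension at least one. -/
theorem exists_stackedMatrix {σ : (Fin n → F) →ₗ[F] (Fin s → F)} (hσ : Function.Surjective σ)
    (hs : 2 ≤ s) (hm : 2 ≤ m) (h0 : ∀ j, σ (Pi.single j 1) ≠ 0)
    (hex : ∀ v : Fin s → F, v ≠ 0 → ∃ j, ∃ c : F, v = c • σ (Pi.single j 1))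
    (hclass : ∀ i, {j | ∃ c : F, σ (Pi.single i 1) = c • σ (Pi.single j 1)}.ncard = m) :
    ∃ (r : ℕ) (e : Fin n ≃ Fin m × Fin (n / m))
      (G : Fin (n / m) → Matrix (Fin (m - 1)) (Fin m) F)
      (M : Fin (n / m) → Matrix (Fin r) (Fin m) F)
      (h : Fin (n / m) → Fin r → F),
      (∀ i, IsBlock (G i)) ∧
      (∀ i, h i ≠ 0 ∧ ∃ c, (M i).col c = h i ∧ ∀ j, j ≠ c → (M i).col j = 0) ∧
      (∃ D : Submodule F (Fin (n / m) → F), IsHammingCode D ∧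
        IsGeneratorMatrix (Matrix.of fun a i => h i a) D) ∧
      IsGeneratorMatrix ((stackedMatrix G M).submatrix id e) (LinearMap.ker σ) := by
  let R : Setoid (Fin n) :=
    { r := fun i j => ∃ c : F, σ (Pi.single i 1) = c • σ (Pi.single j 1)
      iseqv :=
        { refl := fun i => ⟨1, (one_smul _ _).symm⟩
          symm := by
            rintro i j ⟨c, hc⟩
            have : c ≠ 0 := by
              rintro rfl
              exact h0 i (by rw [hc, zero_smul])
            exact ⟨c⁻¹, by rw [hc, inv_smul_smul₀ this]⟩
          trans := by
            rintro i j l ⟨c, hc⟩ ⟨d, hd⟩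
            exact ⟨c * d, by rw [hc, hd, mul_smul]⟩ } }
  obtain ⟨hn, e, he⟩ := exists_equiv_prod_of_card_classes (by omega) R hclass
  generalize n / m = t at hn e
  let c₀ : Fin m := ⟨0, by omega⟩
  let P : Fin t → Fin s → F := fun i => σ (Pi.single (e.symm (c₀, i)) 1)
  have ha : ∀ j i, ∃ a : F, σ (Pi.single (e.symm (j, i)) 1) = a • P i := fun j i =>
    (he _ _).2 (by simp)
  choose a ha using ha
  have hane : ∀ j i, a j i ≠ 0 := fun j i h => h0 (e.symm (j, i)) (by rw [ha, h, zero_smul])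
  have hac : ∀ i, a c₀ i = 1 := fun i =>
    smul_left_injective F (h0 (e.symm (c₀, i))) ((ha c₀ i).symm.trans (one_smul F (P i)).symm)
  have hP : ∀ v : Fin s → F, v ≠ 0 → ∃! i, ∃ c : F, v = c • P i := fun v hv => by
    obtain ⟨l, c, hc⟩ := hex v hv
    have hl : σ (Pi.single l 1) = a (e l).1 (e l).2 • P (e l).2 := by
      rw [← ha, Prod.mk.eta, e.symm_apply_apply]
    refine ⟨(e l).2, ⟨c * a (e l).1 (e l).2, by rw [hc, hl, mul_smul]⟩, ?_⟩
    rintro i ⟨d, hd⟩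
    have hd0 : d ≠ 0 := by
      rintro rfl
      exact hv (by rw [hd, zero_smul])
    have : R (e.symm (c₀, i)) l := ⟨d⁻¹ * c, by
      rw [mul_smul, ← hc, hd, inv_smul_smul₀ hd0]⟩
    simpa using (he _ _).1 this
  obtain ⟨hst, h, hh0, hhP, D, hD, hGD⟩ :=
    exists_hamming_generator hs P (fun i => h0 _) hP
  choose G hGB hGa using fun i => exists_isBlock hm (fun j => a j i) (fun j => hane j i)
  refine ⟨t - s, e, G, fun i => singleColumn c₀ (h i), h, hGB, fun i => ⟨hh0 i, c₀, ?_, ?_⟩,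
    ⟨D, hD, hGD⟩, isGeneratorMatrix_of_card ?_ ?_ ?_⟩
  · ext b
    simp [singleColumn, Matrix.col]
  · intro j hj
    ext b
    simp [singleColumn, Matrix.col, hj]
  · have hli := linearIndependent_stackedMatrix G (fun i => (hGB i).choose_spec.1.1) h hGD.1 c₀ a
      hac hGa
    exact hli.map' (LinearEquiv.funCongrLeft F F e).toLinearMap (LinearEquiv.ker _)
  · have hσe : ∀ y : Fin m × Fin t → F,
        σ (fun l => y (e l)) = ∑ i, (∑ j, a j i * y (j, i)) • P i := fun y => by
      rw [LinearMap.pi_apply_eq_sum_univ σ, ← e.symm.sum_comp, Fintype.sum_prod_type_right]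
      refine Finset.sum_congr rfl fun i _ => ?_
      rw [Finset.sum_smul]
      refine Finset.sum_congr rfl fun j _ => ?_
      rw [e.apply_symm_apply, mul_comm, mul_smul, ← ha]
      congr 2
      ext l
      simp [Pi.single_apply, eq_comm]
    intro x
    change σ (fun l => stackedMatrix G (fun i => singleColumn c₀ (h i)) x (e l)) = 0
    rw [hσe]
    rcases x with ⟨l, i'⟩ | b
    · refine Finset.sum_eq_zero fun i _ => ?_
      by_cases hi : i' = i
      · subst hi
        have := hGa i' l
        simp only [stackedMatrix, Matrix.fromRows_apply_inl, Matrix.blockDiagonal_apply_eq]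
        rw [dotProduct] at this
        rw [this, zero_smul]
      · simp [stackedMatrix, Matrix.blockDiagonal_apply, hi]
    · rw [← hhP b]
      refine Finset.sum_congr rfl fun i _ => ?_
      simp [stackedMatrix, singleColumn, hac]
  · have hrank := σ.finrank_range_add_finrank_ker
    rw [LinearMap.range_eq_top.2 hσ, finrank_top, finrank_fin_fun, finrank_fin_fun] at hrank
    have hcard : Fintype.card ((Fin (m - 1) × Fin t) ⊕ Fin (t - s)) = (m - 1) * t + (t - s) := by
      simp
    rw [hcard]
    obtain ⟨m, rfl⟩ : ∃ m', m = m' + 1 := ⟨m - 1, by omega⟩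
    rw [Nat.add_sub_cancel]
    have : t * (m + 1) = m * t + t := by ring
    omega

end Structure

end CRCode

theorem mainTheorem4 {F : Type*} [Field F] [Fintype F] [DecidableEq F] (n k : ℕ)
    (C : Submodule F (Fin n → F)) (hC : CRCode.IsLinearCode C k 2)
    (hreg : CRCode.IsCompletelyRegular (C : Set (Fin n → F)))
    (hρ : CRCode.IsCoveringRadius (C : Set (Fin n → F)) 1) :
    ∃ na : ℕ, (∀ x : Fin n → F, x ∉ C → CRCode.numAtDist (C : Set (Fin n → F)) x 1 = na) ∧
      ((na = n ∧ k = n - 1 ∧ ∃ G₁ : Matrix (Fin (n - 1)) (Fin n) F,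
          CRCode.IsBlock G₁ ∧ CRCode.IsGeneratorMatrix G₁ C) ∨
        (na < n ∧ k < n - 1 ∧
          ∃ (r : ℕ) (e : Fin n ≃ Fin na × Fin (n / na))
            (G : Fin (n / na) → Matrix (Fin (na - 1)) (Fin na) F)
            (M : Fin (n / na) → Matrix (Fin r) (Fin na) F)
            (h : Fin (n / na) → Fin r → F),
            (∀ i, CRCode.IsBlock (G i)) ∧
            (∀ i, h i ≠ 0 ∧ ∃ c, (M i).col c = h i ∧ ∀ j, j ≠ c → (M i).col j = 0) ∧
            (∃ D : Submodule F (Fin (n / na) → F), CRCode.IsHammingCode D ∧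
              CRCode.IsGeneratorMatrix (Matrix.of fun a i => h i a) D) ∧
            CRCode.IsGeneratorMatrix ((CRCode.stackedMatrix G M).submatrix id e) C)) := by
  obtain ⟨hk, h2⟩ := hC
  obtain ⟨σ, hσ, rfl⟩ := CRCode.exists_syndrome_map C hk
  have h0 := CRCode.map_single_ne_zero h2
  have hex := fun v hv => CRCode.exists_eq_smul_map_single (v := v) hσ hρ hv
  obtain ⟨x₀, hx₀⟩ := hρ.1
  have hx₀C : x₀ ∉ LinearMap.ker σ := fun h => by
    rw [(CRCode.distToCode_eq_zero_iff _ _).2 h] at hx₀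
    omega
  have hna : ∀ x, x ∉ LinearMap.ker σ →
      CRCode.numAtDist (LinearMap.ker σ : Set (Fin n → F)) x 1 =
        CRCode.numAtDist (LinearMap.ker σ : Set (Fin n → F)) x₀ 1 := fun x hx =>
    hreg x x₀ ((CRCode.distToCode_eq_one hρ hx).trans hx₀.symm) 1
  generalize CRCode.numAtDist (LinearMap.ker σ : Set (Fin n → F)) x₀ 1 = m at hna
  refine ⟨m, hna, ?_⟩
  have hcount : ∀ x, σ x ≠ 0 →
      {j | ∃ c : F, σ x = c • σ (Pi.single j 1)}.ncard = m := fun x hx => by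
    rw [← CRCode.numAtDist_one_eq_ncard h0 hx, hna x hx]
  -- A trivial syndrome space would put `x₀` in the code.
  have hkn : 1 ≤ n - k := by
    by_contra h
    refine hx₀C (LinearMap.mem_ker.2 (funext fun i => absurd i.2 ?_))
    omega
  rcases hkn.eq_or_lt with h1 | h1
  · have hmn : m = n := by
      rw [← hcount x₀ hx₀C]
      refine Eq.trans (congrArg Set.ncard (Set.eq_univ_of_forall fun j => ?_))
        ((Set.ncard_univ _).trans (Nat.card_fin n))
      obtain ⟨c, hc⟩ := exists_smul_eq_of_finrank_eq_one
        (by rw [Module.finrank_fin_fun, h1]) (h0 j) (σ x₀)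
      exact ⟨c, hc.symm⟩
    have hk1 : k = n - 1 := by omega
    obtain ⟨G, hG⟩ := CRCode.exists_isGeneratorMatrix (LinearMap.ker σ) (hk.trans hk1)
    exact Or.inl ⟨hmn, hk1, G, ⟨_, hG, ⟨hk.trans hk1, h2⟩, hreg⟩, hG⟩
  · have hclass := fun i => hcount (Pi.single i 1) (h0 i)
    have hm2 : 2 ≤ m := by
      obtain ⟨i, j, hij, c, hc⟩ := CRCode.exists_proportional_columns h2
      rw [← hclass i]
      exact (Set.one_lt_ncard (Set.toFinite _)).2 ⟨i, ⟨1, (one_smul _ _).symm⟩, j, ⟨c, hc⟩, hij⟩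
    have hmn : m < n := by
      -- A column on the line of some `w` off the line of `σ x₀` is not counted by `m`.
      obtain ⟨w, hw⟩ : ∃ w, ∀ c : F, c • σ x₀ ≠ w := by
        by_contra! h
        have := finrank_le_one (σ x₀) h
        rw [Module.finrank_fin_fun] at this
        omega
      obtain ⟨j, b, hb⟩ := hex w fun h => hw 0 (by rw [zero_smul, h])
      rw [← hcount x₀ hx₀C]
      refine (Set.ncard_lt_card fun huniv => ?_).trans_eq (Nat.card_fin n)
      obtain ⟨c, hc⟩ : j ∈ {j | ∃ c : F, σ x₀ = c • σ (Pi.single j 1)} := huniv ▸ Set.mem_univ j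
      have hc0 : c ≠ 0 := by
        rintro rfl
        exact hx₀C (LinearMap.mem_ker.2 (by rw [hc, zero_smul]))
      exact hw (b * c⁻¹) (by rw [mul_smul, hc, inv_smul_smul₀ hc0, hb])
    exact Or.inr ⟨hmn, by omega,
      CRCode.exists_stackedMatrix hσ h1 hm2 h0 hex hclass⟩
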